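/- Let $K_{n+1}$ be the complete graph on $v_1,\dots,v_{n+1}$ with one directed edge $(v_i,v_j)$ for every $i<j$. For ${\bf a}\in\mathbb{N}^n$ let $\mathrm{Flow}_n({\bf a})$ be the polytope of all functions $\phi\ge 0$ on the edges of $K_{n+1}$ such that, for each $1\le i\le n$, $\sum_{j>i}\phi(v_i,v_j)-\sum_{k<i}\phi(v_k,v_i)=a_i$, and let $CRY_n=\mathrm{Flow}_n(1,0,\dots,0)$ be the Chan–Robbins–Yuen polytope. Let $f^{(n)}(x)=\sum_{d\ge -1}f^{(n)}_d x^d$, where $f^{(n)}_d$ is the number of $d$-dimensional faces of $CRY_n$, and the empty face is counted with dimension $-1$. Put $\pi_k(x)=\prod_{i=1}^{k}((x+1)^i-1)$, and let $h_m$ be the complete homogeneous symmetric polynomial of degree $m$ (in no variables, $h_0=1$ and $h_m=0$ for $m\ge1$). Then for all $n\ge 1$, as Laurent polynomials in $x$, $$f^{(n)}(x)=\frac1x+\frac1{x^n}\sum_{m=0}^{n-1}(-1)^m(1+x)^m\,\pi_{n-m}(x)\,h_m\bigl((x+1)^1-1,(x+1)^2-1,\dots,(x+1)^{n-m-1}-1\bigr).$$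 For $n\ge2$ the term $m=n-1$ vanishes, so that the sum may be taken over $0\le m\le n-2$. Moreover, let $\Omega_n$ be the set of nonempty subgraphs $H$ of $K_{n+1}$ such that every vertex of $H$ lies along a directed path in $H$ from $v_1$ to $v_{n+1}$. Then $f^{(n)}(1)=1+|\Omega_n|$, and setting $x=1$ gives the formula of Andresen and Kjeldsen: for all $n\ge1$, $$|\Omega_n|=\sum_{m=0}^{n-1}(-2)^m\,\pi_{n-m}(1)\,h_m\bigl(2^1-1,2^2-1,\dots,2^{n-m-1}-1\bigr).$$ -/

import Mathlib

open scoped LaurentPolynomial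

/-- The edges of the complete graph `K_{n+1}`, transitively directed: the vertices are
`0, …, n` (standing for `v_1, …, v_{n+1}`) and there is one edge `(i, j)` for all `i < j`. -/
abbrev KEdge (n : ℕ) : Type := {e : Fin (n + 1) × Fin (n + 1) // e.1 < e.2}

/-- The flow polytope `Flow_n(a)` of `K_{n+1}` with netflow vector `(a_1, …, a_n, -∑ a_i)`: the
nonnegative flows on the edges whose net outflow at the `i`-th vertex is `a_i`, for the first `n`
vertices (conservation at the last vertex follows from the others). -/
def FlowPolytope (n : ℕ) (a : Fin n → ℕ) : Set (KEdge n → ℝ) :=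
  {f | (∀ e, 0 ≤ f e) ∧
    ∀ i : Fin n,
      (∑ e : KEdge n with e.1.1 = i.castSucc, f e) -
        (∑ e : KEdge n with e.1.2 = i.castSucc, f e) = (a i : ℝ)}

/-- The Chan–Robbins–Yuen polytope `CRY_n = Flow_n(1, 0, …, 0)`. -/
def CRY (n : ℕ) : Set (KEdge n → ℝ) :=
  FlowPolytope n (fun i => if (i : ℕ) = 0 then 1 else 0)

section Faces

variable {E : Type*} [AddCommGroup E] [Module ℝ E] [TopologicalSpace E]

/-- The faces of a polytope `P`: the empty face, and the sets of maximizers over `P` of a linear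
functional (the zero functional gives `P` itself). -/
def faces (P : Set E) : Set (Set E) := {F | IsExposed ℝ P F}

open Classical in
/-- The dimension of a face: the dimension of its affine hull, and `-1` for the empty face. -/
noncomputable def faceDim (F : Set E) : ℤ :=
  if F = ∅ then -1 else (Module.finrank ℝ (affineSpan ℝ F).direction : ℤ)

/-- The number of `d`-dimensional faces of `P`, for `d ≥ -1`. -/
noncomputable def fVector (P : Set E) (d : ℤ) : ℕ :=
  {F | F ∈ faces P ∧ faceDim F = d}.ncard

/-- The `f`-polynomial of a polytope `P`: the Laurent polynomial in which the coefficient of `x^d`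
is the number of `d`-dimensional faces of `P`, for `-1 ≤ d ≤ dim P`. -/
noncomputable def fPolynomial (P : Set E) : ℤ[T;T⁻¹] :=
  ∑ d ∈ Finset.Icc (-1 : ℤ) (faceDim P), (fVector P d : ℤ[T;T⁻¹]) * LaurentPolynomial.T d

end Faces

section Formula

variable {R : Type*} [CommRing R]

/-- `π_k(x) = ∏_{i=1}^k ((x+1)^i - 1)`. -/
def piProd (k : ℕ) (x : R) : R :=
  ∏ i ∈ Finset.Icc 1 k, ((x + 1) ^ i - 1)

/-- `h_m((x+1)^1 - 1, (x+1)^2 - 1, …, (x+1)^k - 1)`, where `h_m` is the complete homogeneous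
symmetric polynomial of degree `m` in `k` variables. -/
noncomputable def hEval (m k : ℕ) (x : R) : R :=
  MvPolynomial.aeval (fun i : Fin k => (x + 1) ^ ((i : ℕ) + 1) - 1)
    (MvPolynomial.hsymm (Fin k) ℤ m)

end Formula

/-- A (nonempty) subgraph of `K_{n+1}`: a nonempty set of vertices together with a set of edges
of `K_{n+1}` between them. -/
@[ext]
structure KSubgraph (n : ℕ) where
  verts : Set (Fin (n + 1))
  edges : Set (KEdge n)
  nonempty : verts.Nonempty
  fst_mem : ∀ e ∈ edges, e.1.1 ∈ verts
  snd_mem : ∀ e ∈ edges, e.1.2 ∈ verts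

/-- There is an edge of `H` from `i` to `j`. -/
def KSubgraph.Adj {n : ℕ} (H : KSubgraph n) (i j : Fin (n + 1)) : Prop :=
  ∃ h : i < j, (⟨(i, j), h⟩ : KEdge n) ∈ H.edges

/-- `p` lists the vertices of a directed path of `H` from the first to the last vertex
of `K_{n+1}`. -/
def KSubgraph.IsPath {n : ℕ} (H : KSubgraph n) (p : List (Fin (n + 1))) : Prop :=
  p.IsChain H.Adj ∧ p.head? = some 0 ∧ p.getLast? = some (Fin.last n)

/-- `Ω_n`: the nonempty subgraphs `H` of `K_{n+1}` each of whose vertices lies along a directed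
path of `H` from the first to the last vertex of `K_{n+1}`. -/
def Omega (n : ℕ) : Set (KSubgraph n) :=
  {H | ∀ v ∈ H.verts, ∃ p, H.IsPath p ∧ v ∈ p}

/-!
Both counts are reduced to the admissible edge sets `S` of `K_{n+1}`: nonempty, and such that each
vertex other than the source and the sink is entered by an edge of `S` iff it is left by one.

*Faces.* The support of a flow in `CRY n` is admissible (`admissible_support`). Conversely, letting
one unit flow out of the source and splitting the inflow of each vertex equally gives a flow whose
support is exactly a prescribed admissible `S` (`Admissible.splitFlow_mem`,
`Admissible.splitFlow_pos`). Hence `S ↦ flowFace S`, the flows supported in `S`, is injective on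
admissible sets, and it hits every nonempty exposed face: a functional that is maximal over `CRY n`
at a flow of support `S` is constant on `flowFace S`, as that flow can be moved slightly in every
direction of `flowFace S` (`exists_eq_flowFace`). The directions of `flowFace S` are the
circulations on `S`. The netflow map on `ℝ^S` has rank the number of vertices other than the sink
that `S` meets, that is, the number of tails of edges of `S`; so the dimension of `flowFace S` is
`#S - #(tails S)`, the first Betti number of the graph (`Admissible.faceDim_flowFace`).

*Graphs.* A graph in `Omega n` has no isolated vertices, and its edge set is admissible; walking
along an admissible set reaches the source and the sink (`ncard_Omega`).

*Counting.* It remains to find `∑_S x^(#S) x^(n - #(tails S))` (`sum_admissible`). Here `x` is the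
weight of an edge and also of an inner vertex that `S` does not meet. Write `in u`, `out u` for the
indicators of the presence of entering and leaving edges. The local condition and weight at an
inner vertex `u` are
`in u + (1 - out u) (x (1 - in u) - in u)`.
Expand the product over `u`: some vertices are declared dead, and nothing may leave them; the
others are alive and subject to no condition on leaving edges. The sum over `S` then factors over
the sets of edges entering each vertex. If `r` vertices before `u` are alive, and
`q_r = (x+1)^r - 1`, then an alive `u` contributes `q_r`, a dead one `x - q_r = -(x+1) q_{r-1}`,
and the sink `q_r`. So the sum is over walks that start at `r = 1` and at each of the `n - 1` inner
vertices go up by one or stay. Walks that stay `m` times contribute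
`q_1 ⋯ q_{n-m} (-(x+1))^m h_m(q_0, …, q_{n-m-1})`, and `q_0 = 0` (`transferStep_iterate`).
-/

/-! ### Complete homogeneous symmetric polynomials at the points `(x+1)^i - 1` -/

section Formula

variable {R : Type*} [CommRing R]

theorem hEval_zero_left (k : ℕ) (x : R) : hEval 0 k x = 1 := by
  simp [hEval]

theorem hEval_succ_zero (m : ℕ) (x : R) : hEval (m + 1) 0 x = 0 := by
  simp [hEval, MvPolynomial.hsymm]

theorem aeval_hsymm_option {σ : Type*} [Fintype σ] [DecidableEq σ] (m : ℕ) (g : Option σ → R) :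
    MvPolynomial.aeval g (MvPolynomial.hsymm (Option σ) ℤ (m + 1)) =
      MvPolynomial.aeval (fun i => g (some i)) (MvPolynomial.hsymm σ ℤ (m + 1)) +
        g none * MvPolynomial.aeval g (MvPolynomial.hsymm (Option σ) ℤ m) := by
  have key (τ : Type _) [Fintype τ] [DecidableEq τ] (k : ℕ) (g : τ → R) :
      MvPolynomial.aeval g (MvPolynomial.hsymm τ ℤ k) =
        ∑ s : Sym τ k, ((s : Multiset τ).map g).prod := by
    simp only [MvPolynomial.hsymm, map_sum]
    refine Finset.sum_congr rfl fun s _ => ?_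
    rw [map_multiset_prod, Multiset.map_map]
    simp only [Function.comp_def, MvPolynomial.aeval_X]
    rfl
  rw [key, key, key, ← Equiv.sum_comp (symOptionSuccEquiv (α := σ) (n := m)).symm,
    Fintype.sum_sum_type, add_comm, Finset.mul_sum]
  congr 1
  · refine Finset.sum_congr rfl fun s _ => ?_
    simp [symOptionSuccEquiv, SymOptionSuccEquiv.decode, Multiset.map_map]
  · refine Finset.sum_congr rfl fun s _ => ?_
    change (Multiset.map g (none ::ₘ (s : Multiset (Option σ)))).prod = _
    rw [Multiset.map_cons, Multiset.prod_cons]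

/-- The recursion `h_{m+1}(q_1, …, q_{k+1}) = h_{m+1}(q_1, …, q_k) + q_{k+1} h_m(q_1, …, q_{k+1})`
at `q_i = (x+1)^i - 1`. -/
theorem hEval_succ_succ (m k : ℕ) (x : R) :
    hEval (m + 1) (k + 1) x =
      hEval (m + 1) k x + ((x + 1) ^ (k + 1) - 1) * hEval m (k + 1) x := by
  have h (j : ℕ) : hEval j (k + 1) x =
      MvPolynomial.aeval (fun o : Option (Fin k) =>
        (x + 1) ^ ((finSuccEquivLast.symm o : Fin (k + 1)).val + 1) - 1)
        (MvPolynomial.hsymm (Option (Fin k)) ℤ j) := by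
    rw [hEval, ← MvPolynomial.rename_hsymm (Option (Fin k)) ℤ j finSuccEquivLast.symm,
      MvPolynomial.aeval_rename]
    rfl
  rw [h, h, aeval_hsymm_option]
  simp [hEval]

theorem piProd_succ (k : ℕ) (x : R) :
    piProd (k + 1) x = piProd k x * ((x + 1) ^ (k + 1) - 1) := by
  rw [piProd, Finset.prod_Icc_succ_top (by omega), piProd]

/-- One step of the vertex-by-vertex count: with `r` vertices already alive, the next vertex either
becomes alive (`r` grows) or is dead (`r` stays), with the two weights shown. -/
def transferStep (x : R) (g : ℕ → R) (r : ℕ) : R :=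
  ((x + 1) ^ r - 1) * g (r + 1) + (x + 1 - (x + 1) ^ r) * g r

/-- A walk of `N` steps from `1` that stays in place `m` times collects `q_1 ⋯ q_k` from its
`k = N - m` steps up, and one factor `-(x+1) q_{r-1}` for each stay at `r ≤ k + 1`; the sum over
all positions of the stays is the complete homogeneous symmetric polynomial (`q_0 = 0`). -/
theorem transferStep_iterate (x : R) (N : ℕ) (g : ℕ → R) :
    (transferStep x)^[N] g 1 = ∑ p ∈ Finset.HasAntidiagonal.antidiagonal N,
      (-(1 + x)) ^ p.1 * piProd p.2 x * hEval p.1 p.2 x * g (p.2 + 1) := by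
  induction N generalizing g with
  | zero => simp [hEval_zero_left, piProd]
  | succ N ih =>
    rw [Function.iterate_succ_apply, ih]
    set c : ℕ → ℕ → R := fun m k => (-(1 + x)) ^ m * piProd k x * hEval m k x with hc
    set u : ℕ → ℕ → R := fun m k => match k with
      | 0 => 0
      | k + 1 => c m k * ((x + 1) ^ (k + 1) - 1) with hu
    set w : ℕ → ℕ → R := fun m k => match m with
      | 0 => 0
      | m + 1 => c m k * (-(1 + x) * ((x + 1) ^ k - 1)) with hw
    have h1 : ∀ p ∈ Finset.HasAntidiagonal.antidiagonal (N + 1), c p.1 p.2 * g (p.2 + 1) =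
        u p.1 p.2 * g (p.2 + 1) + w p.1 p.2 * g (p.2 + 1) := by
      rintro ⟨m, k⟩ hp
      rw [← add_mul]
      congr 1
      rcases m with _ | m <;> rcases k with _ | k
      · simp at hp
      · simp only [hc, hu, hw, piProd_succ, hEval_zero_left]; ring
      · simp only [hc, hu, hw, hEval_succ_zero]; ring
      · simp only [hc, hu, hw, piProd_succ, hEval_succ_succ]; ring
    rw [Finset.sum_congr rfl h1, Finset.sum_add_distrib,
      Finset.Nat.sum_antidiagonal_succ' (f := fun p => u p.1 p.2 * g (p.2 + 1)),
      Finset.Nat.sum_antidiagonal_succ (f := fun p => w p.1 p.2 * g (p.2 + 1))]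
    simp only [hu, hw, zero_mul, zero_add, ← Finset.sum_add_distrib]
    refine Finset.sum_congr rfl fun p _ => ?_
    simp only [transferStep, hc]
    ring

/-- The number of vertices `i < u` that are alive, when the vertex `0` and those of `A` are. -/
def aliveBelow (A : Finset ℕ) (u : ℕ) : ℕ :=
  ((Finset.range u).filter fun i => i = 0 ∨ i ∈ A).card

theorem aliveBelow_insert {A : Finset ℕ} {u N : ℕ} (h : u ≤ N) :
    aliveBelow (insert N A) u = aliveBelow A u := by
  unfold aliveBelow
  congr 1
  ext i
  simp only [Finset.mem_filter, Finset.mem_range, Finset.mem_insert]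
  constructor
  · rintro ⟨h1, h2⟩
    refine ⟨h1, ?_⟩
    rcases h2 with h2 | h2 | h2
    · exact Or.inl h2
    · omega
    · exact Or.inr h2
  · tauto

theorem aliveBelow_succ (A : Finset ℕ) (u : ℕ) :
    aliveBelow A (u + 1) = aliveBelow A u + if u = 0 ∨ u ∈ A then 1 else 0 := by
  unfold aliveBelow
  rw [Finset.range_add_one, Finset.filter_insert]
  split_ifs with h <;> simp

/-- Summing over the set `A` of alive inner vertices, each vertex weighted according to the number
of alive vertices before it, amounts to iterating `transferStep` from the single alive vertex `0`;
`g` is the weight of the last vertex. -/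
theorem sum_powerset_alive (x : R) (N : ℕ) (g : ℕ → R) :
    ∑ A ∈ (Finset.Ico 1 (N + 1)).powerset,
      (∏ u ∈ Finset.Ico 1 (N + 1), if u ∈ A then (x + 1) ^ aliveBelow A u - 1
        else x + 1 - (x + 1) ^ aliveBelow A u) * g (aliveBelow A (N + 1)) =
      (transferStep x)^[N] g 1 := by
  induction N generalizing g with
  | zero => simp [aliveBelow, Finset.filter_singleton]
  | succ N ih =>
    have hI : Finset.Ico 1 (N + 1 + 1) = insert (N + 1) (Finset.Ico 1 (N + 1)) := by
      ext i; simp only [Finset.mem_insert, Finset.mem_Ico]; omega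
    have hN : N + 1 ∉ Finset.Ico 1 (N + 1) := by simp
    rw [Function.iterate_succ_apply, ← ih, hI, Finset.sum_powerset_insert hN,
      ← Finset.sum_add_distrib]
    refine Finset.sum_congr rfl fun A hA => ?_
    have hNA : N + 1 ∉ A := fun h => hN (Finset.mem_powerset.1 hA h)
    rw [Finset.prod_insert hN, Finset.prod_insert hN, if_neg hNA,
      if_pos (Finset.mem_insert_self _ _), aliveBelow_insert le_rfl, aliveBelow_succ _ (N + 1),
      aliveBelow_succ _ (N + 1), if_neg (by simpa using hNA), if_pos (by simp),
      aliveBelow_insert le_rfl]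
    have hprod : (∏ u ∈ Finset.Ico 1 (N + 1), if u ∈ insert (N + 1) A
          then (x + 1) ^ aliveBelow (insert (N + 1) A) u - 1
          else x + 1 - (x + 1) ^ aliveBelow (insert (N + 1) A) u) =
        ∏ u ∈ Finset.Ico 1 (N + 1), if u ∈ A then (x + 1) ^ aliveBelow A u - 1
          else x + 1 - (x + 1) ^ aliveBelow A u := by
      refine Finset.prod_congr rfl fun u hu => ?_
      have : u < N + 1 := (Finset.mem_Ico.1 hu).2
      rw [aliveBelow_insert this.le]
      simp [this.ne]
    rw [hprod, transferStep]
    simp only [add_zero]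
    ring

theorem sum_powerset_alive_eq (x : R) {n : ℕ} (hn : 1 ≤ n) :
    ∑ A ∈ (Finset.Ico 1 n).powerset,
      (∏ u ∈ Finset.Ico 1 n, if u ∈ A then (x + 1) ^ aliveBelow A u - 1
        else x + 1 - (x + 1) ^ aliveBelow A u) * ((x + 1) ^ aliveBelow A n - 1) =
      ∑ m ∈ Finset.range n,
        (-1) ^ m * (1 + x) ^ m * piProd (n - m) x * hEval m (n - m - 1) x := by
  obtain ⟨N, rfl⟩ : ∃ N, n = N + 1 := ⟨n - 1, by omega⟩
  rw [sum_powerset_alive x N (fun r => (x + 1) ^ r - 1), transferStep_iterate,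
    Finset.Nat.sum_antidiagonal_eq_sum_range_succ_mk]
  refine Finset.sum_congr rfl fun m hm => ?_
  have hm' : m ≤ N := by simpa [Nat.lt_succ_iff] using hm
  rw [show N + 1 - m = (N - m) + 1 by omega, piProd_succ, Nat.add_sub_cancel, neg_pow]
  ring

end Formula

/-! ### The weighted count of admissible edge sets -/

section Counting

/-- An edge set of `K_{n+1}` is admissible if it is nonempty and an edge can always be continued:
backwards unless it leaves the source, and forwards unless it enters the sink. These are the
supports of the flows in `CRY n` and the edge sets of the graphs in `Omega n`. -/
def Admissible {n : ℕ} (S : Finset (KEdge n)) : Prop :=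
  S.Nonempty ∧ ∀ e ∈ S, (e.1.1 ≠ 0 → ∃ e' ∈ S, e'.1.2 = e.1.1) ∧
    (e.1.2 ≠ Fin.last n → ∃ e' ∈ S, e'.1.1 = e.1.2)

/-- Some edge of `S` enters the vertex `v`. -/
def HasIn {n : ℕ} (S : Finset (KEdge n)) (v : ℕ) : Prop := ∃ e ∈ S, (e.1.2 : ℕ) = v

/-- Some edge of `S` leaves the vertex `v`. -/
def HasOut {n : ℕ} (S : Finset (KEdge n)) (v : ℕ) : Prop := ∃ e ∈ S, (e.1.1 : ℕ) = v

/-- The vertices from which some edge of `S` leaves. -/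
def tails {n : ℕ} (S : Finset (KEdge n)) : Finset (Fin (n + 1)) := S.image fun e => e.1.1

variable {n : ℕ} {S : Finset (KEdge n)}

theorem Admissible.hasOut_zero (h : Admissible S) : HasOut S 0 := by
  obtain ⟨e, he, hmin⟩ := S.exists_min_image (fun e => e.1.1) h.1
  by_cases h0 : e.1.1 = 0
  · exact ⟨e, he, by simp [h0]⟩
  · obtain ⟨e', he', h'⟩ := (h.2 e he).1 h0
    exact absurd (h' ▸ e'.2) (not_lt.2 (hmin e' he'))

theorem Admissible.hasIn_last (h : Admissible S) : HasIn S n := by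
  obtain ⟨e, he, hmax⟩ := S.exists_max_image (fun e => e.1.2) h.1
  by_cases h0 : e.1.2 = Fin.last n
  · exact ⟨e, he, by simp [h0]⟩
  · obtain ⟨e', he', h'⟩ := (h.2 e he).2 h0
    exact absurd (h' ▸ e'.2) (not_lt.2 (hmax e' he'))

theorem admissible_iff :
    Admissible S ↔ HasIn S n ∧ ∀ u ∈ Finset.Ico 1 n, (HasIn S u ↔ HasOut S u) := by
  constructor
  · intro h
    refine ⟨h.hasIn_last, fun u hu => ⟨?_, ?_⟩⟩
    · rintro ⟨e, he, rfl⟩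
      obtain ⟨e', he', h'⟩ := (h.2 e he).2 (fun hl => by simp [hl] at hu)
      exact ⟨e', he', by rw [h']⟩
    · rintro ⟨e, he, rfl⟩
      obtain ⟨e', he', h'⟩ := (h.2 e he).1 (fun hl => by simp [hl] at hu)
      exact ⟨e', he', by rw [h']⟩
  · rintro ⟨⟨e₀, he₀, -⟩, h⟩
    refine ⟨⟨e₀, he₀⟩, fun e he => ⟨fun h0 => ?_, fun hl => ?_⟩⟩
    · have h1 : (e.1.1 : ℕ) ∈ Finset.Ico 1 n := by
        have := Fin.val_ne_zero_iff.2 h0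
        have h2 : (e.1.1 : ℕ) < e.1.2 := e.2
        have := e.1.2.is_lt
        simp; omega
      obtain ⟨e', he', h'⟩ := (h _ h1).2 ⟨e, he, rfl⟩
      exact ⟨e', he', Fin.ext h'⟩
    · have h1 : (e.1.2 : ℕ) ∈ Finset.Ico 1 n := by
        have := Fin.val_ne_of_ne hl
        have h2 : (e.1.1 : ℕ) < e.1.2 := e.2
        have := e.1.2.is_lt
        simp at *; omega
      obtain ⟨e', he', h'⟩ := (h _ h1).1 ⟨e, he, rfl⟩
      exact ⟨e', he', Fin.ext h'⟩

theorem tails_card_le (S : Finset (KEdge n)) : (tails S).card ≤ n := by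
  have : tails S ⊆ Finset.univ.erase (Fin.last n) := by
    intro v hv
    obtain ⟨e, -, rfl⟩ := Finset.mem_image.1 hv
    simpa using (e.2.trans_le (Fin.le_last _)).ne
  simpa using Finset.card_le_card this

open Classical in
theorem Admissible.card_filter_not_hasOut (h : Admissible S) :
    ((Finset.Ico 1 n).filter fun u => ¬ HasOut S u).card = n - (tails S).card := by
  have h1 : (tails S).card = ((Finset.range n).filter fun u => HasOut S u).card := by
    rw [← Finset.card_map Fin.valEmbedding]
    congr 1
    ext u
    simp only [tails, Finset.mem_map, Finset.mem_image, Finset.mem_filter, Finset.mem_range,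
      Fin.valEmbedding_apply]
    constructor
    · rintro ⟨_, ⟨e, he, rfl⟩, rfl⟩
      exact ⟨(Fin.lt_def.1 e.2).trans_le (Nat.le_of_lt_succ e.1.2.is_lt), e, he, rfl⟩
    · rintro ⟨-, e, he, rfl⟩
      exact ⟨_, ⟨e, he, rfl⟩, rfl⟩
  have h2 : ((Finset.Ico 1 n).filter fun u => ¬ HasOut S u) =
      (Finset.range n).filter fun u => ¬ HasOut S u := by
    ext u
    simp only [Finset.mem_filter, Finset.mem_Ico, Finset.mem_range]
    refine ⟨fun ⟨a, b⟩ => ⟨a.2, b⟩, fun ⟨a, b⟩ => ⟨⟨?_, a⟩, b⟩⟩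
    rcases u with _ | u
    · exact absurd h.hasOut_zero b
    · omega
  have h3 := Finset.card_filter_add_card_filter_not (s := Finset.range n) (fun u => HasOut S u)
  rw [h2, h1]
  simp only [Finset.card_range] at h3
  omega

/-- Choosing a subset of a fibred finite type is choosing a subset of each fibre. -/
theorem sum_prod_filter_fiber {E ι R : Type*} [Fintype E] [DecidableEq E] [Fintype ι]
    [DecidableEq ι] [CommRing R] (h : E → ι) (φ : ι → Finset E → R) :
    ∑ S : Finset E, ∏ i, φ i (S.filter fun e => h e = i) =
      ∏ i, ∑ T ∈ (Finset.univ.filter fun e => h e = i).powerset, φ i T := by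
  rw [Finset.prod_univ_sum]
  refine Finset.sum_bij' (fun S _ i => S.filter fun e => h e = i)
    (fun p _ => Finset.univ.biUnion p) ?_ ?_ ?_ ?_ ?_
  · intro S _
    exact Fintype.mem_piFinset.2 fun i => Finset.mem_powerset.2 fun e he => by
      simpa using (Finset.mem_filter.1 he).2
  · simp
  · intro S _
    ext e
    simp
  · intro p hp
    funext i
    ext e
    have hp' : ∀ j, ∀ e ∈ p j, h e = j := fun j e he => by
      simpa using Finset.mem_powerset.1 (Fintype.mem_piFinset.1 hp j) he
    simp only [Finset.mem_filter, Finset.mem_biUnion, Finset.mem_univ, true_and]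
    constructor
    · rintro ⟨⟨j, hj⟩, rfl⟩
      rwa [hp' j e hj]
    · exact fun he => ⟨⟨i, he⟩, hp' i e he⟩
  · intros
    rfl

variable {R : Type*} [CommRing R]

open Classical in
theorem sum_powerset_nonempty {E : Type*} (F : Finset E) (w : E → R) (a b : R) :
    ∑ T ∈ F.powerset, (∏ e ∈ T, w e) * (if T.Nonempty then a else b) =
      a * (∏ e ∈ F, (1 + w e)) - a + b := by
  have h1 : ∀ T ∈ F.powerset, (∏ e ∈ T, w e) * (if T.Nonempty then a else b) =
      a * (∏ e ∈ T, w e) + if T = ∅ then b - a else 0 := by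
    intro T _
    rcases T.eq_empty_or_nonempty with rfl | hT
    · simp
    · simp [hT, hT.ne_empty, mul_comm]
  rw [Finset.sum_congr rfl h1, Finset.sum_add_distrib, ← Finset.mul_sum, ← Finset.prod_one_add,
    Finset.sum_ite_eq' _ _ _, if_pos (Finset.empty_mem_powerset _)]
  ring

/-- The weight of an edge when only the edges leaving the vertex `0` or a vertex of `A` are
allowed. -/
def aliveWeight (x : R) (A : Finset ℕ) (e : KEdge n) : R :=
  if (e.1.1 : ℕ) = 0 ∨ (e.1.1 : ℕ) ∈ A then x else 0

theorem prod_one_add_aliveWeight (x : R) (A : Finset ℕ) (v : Fin (n + 1)) :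
    ∏ e ∈ Finset.univ.filter (fun e : KEdge n => e.1.2 = v), (1 + aliveWeight x A e) =
      (x + 1) ^ aliveBelow A v := by
  have h1 : ∏ e ∈ Finset.univ.filter (fun e : KEdge n => e.1.2 = v), (1 + aliveWeight x A e) =
      ∏ i ∈ Finset.range v, if i = 0 ∨ i ∈ A then x + 1 else 1 := by
    refine Finset.prod_bij (fun e _ => (e.1.1 : ℕ)) ?_ ?_ ?_ ?_
    · intro e he
      have := (Finset.mem_filter.1 he).2
      simpa [← this] using e.2
    · intro e he e' he' h
      exact Subtype.ext (Prod.ext (Fin.ext h)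
        ((Finset.mem_filter.1 he).2.trans (Finset.mem_filter.1 he').2.symm))
    · intro i hi
      have hi' := Finset.mem_range.1 hi
      exact ⟨⟨(⟨i, hi'.trans v.is_lt⟩, v), hi'⟩, by simp, rfl⟩
    · intro e _
      unfold aliveWeight
      split_ifs <;> ring
  rw [h1, Finset.prod_ite, Finset.prod_const, Finset.prod_const_one, mul_one, aliveBelow]

open Classical in
/-- Expansion of the condition `HasIn S u ↔ HasOut S u` over the set of vertices `u` at which
the summand containing `¬ HasOut S u` is chosen; `A` is the complement of that set. -/
theorem admissible_weight (x : R) (S : Finset (KEdge n)) :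
    (if Admissible S then x ^ S.card * x ^ (n - (tails S).card) else 0) =
      ∑ A ∈ (Finset.Ico 1 n).powerset, (∏ e ∈ S, aliveWeight x A e) *
        ((∏ u ∈ Finset.Ico 1 n, if HasIn S u then (if u ∈ A then 1 else -1)
          else if u ∈ A then 0 else x) * if HasIn S n then 1 else 0) := by
  have h1 : (if Admissible S then x ^ S.card * x ^ (n - (tails S).card) else 0) =
      x ^ S.card * (∏ u ∈ Finset.Ico 1 n, ((if HasIn S u then 1 else 0) +
        (if HasOut S u then 0 else if HasIn S u then -1 else x))) *
          if HasIn S n then 1 else 0 := by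
    split_ifs with h hn hn
    · rw [mul_one, ← h.card_filter_not_hasOut]
      congr 1
      rw [← Finset.prod_const, Finset.prod_filter]
      refine Finset.prod_congr rfl fun u hu => ?_
      have := (admissible_iff.1 h).2 u hu
      by_cases ho : HasOut S u <;> simp [ho, this]
    · exact absurd h.hasIn_last hn
    · have : ∃ u ∈ Finset.Ico 1 n, ¬ (HasIn S u ↔ HasOut S u) := by
        by_contra hc
        push Not at hc
        exact h (admissible_iff.2 ⟨hn, hc⟩)
      obtain ⟨u, hu, hne⟩ := this
      rw [Finset.prod_eq_zero hu, mul_zero, zero_mul]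
      by_cases ho : HasOut S u <;> by_cases hi : HasIn S u <;> simp_all
    · simp
  rw [h1, Finset.prod_add, Finset.mul_sum, Finset.sum_mul]
  refine Finset.sum_congr rfl fun A hA => ?_
  rw [Finset.mem_powerset] at hA
  rw [← mul_assoc (∏ e ∈ S, aliveWeight x A e)]
  congr 1
  by_cases hS : ∃ u ∈ Finset.Ico 1 n \ A, HasOut S u
  · -- a forbidden tail makes both sides vanish
    obtain ⟨u, hu, ho⟩ := hS
    rw [Finset.prod_eq_zero hu (by simp [ho]), mul_zero, mul_zero]
    obtain ⟨e, he, rfl⟩ := ho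
    rw [Finset.mem_sdiff, Finset.mem_Ico] at hu
    rw [Finset.prod_eq_zero he, zero_mul]
    rw [aliveWeight, if_neg]
    rintro (h | h)
    · omega
    · exact hu.2 h
  · push Not at hS
    have h2 : ∏ e ∈ S, aliveWeight x A e = x ^ S.card := by
      rw [← Finset.prod_const]
      refine Finset.prod_congr rfl fun e he => if_pos ?_
      by_contra hc
      push Not at hc
      refine hS e.1.1 ?_ ⟨e, he, rfl⟩
      have h2 : (e.1.1 : ℕ) < e.1.2 := e.2
      have := e.1.2.is_lt
      simp only [Finset.mem_sdiff, Finset.mem_Ico]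
      exact ⟨by omega, hc.2⟩
    rw [h2]
    congr 1
    rw [← Finset.prod_sdiff hA, mul_comm]
    congr 1
    · refine Finset.prod_congr rfl fun u hu => ?_
      rw [if_neg (hS u hu)]
      simp [(Finset.mem_sdiff.1 hu).2]
    · exact Finset.prod_congr rfl fun u hu => by simp [hu]

open Classical in
/-- The generating function of the admissible edge sets. Since `S` determines a graph on
`#(tails S) + 1` vertices, the exponent of `x` exceeds its first Betti number by `n`. -/
theorem sum_admissible (x : R) (hn : 1 ≤ n) :
    ∑ S : Finset (KEdge n) with Admissible S, x ^ S.card * x ^ (n - (tails S).card) =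
      ∑ m ∈ Finset.range n,
        (-1) ^ m * (1 + x) ^ m * piProd (n - m) x * hEval m (n - m - 1) x := by
  rw [Finset.sum_filter, ← sum_powerset_alive_eq x hn,
    Finset.sum_congr rfl fun S _ => admissible_weight x S, Finset.sum_comm]
  refine Finset.sum_congr rfl fun A _ => ?_
  -- the values at a nonempty and an empty in-neighbourhood of `v`
  set a : ℕ → R := fun v => if v = n then 1 else if v ∈ A then 1 else -1
  set b : ℕ → R := fun v => if v = n then 0 else if v ∈ A then 0 else x
  have hsplit (f : ℕ → R) (f0 : f 0 = 1) :
      ∏ v : Fin (n + 1), f v = (∏ u ∈ Finset.Ico 1 n, f u) * f n := by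
    rw [← Finset.prod_range, Finset.prod_range_succ, Finset.range_eq_Ico,
      Finset.prod_eq_prod_Ico_succ_bot (by omega), f0, one_mul]
  have hterm (S : Finset (KEdge n)) : (∏ e ∈ S, aliveWeight x A e) *
        ((∏ u ∈ Finset.Ico 1 n, if HasIn S u then (if u ∈ A then 1 else -1)
          else if u ∈ A then 0 else x) * if HasIn S n then 1 else 0) =
      ∏ v : Fin (n + 1), (∏ e ∈ S.filter (fun e => e.1.2 = v), aliveWeight x A e) *
        if (v : ℕ) = 0 then 1 else
          if (S.filter (fun e => e.1.2 = v)).Nonempty then a v else b v := by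
    rw [Finset.prod_mul_distrib, Finset.prod_fiberwise]
    congr 1
    have hne (v : Fin (n + 1)) : (S.filter (fun e => e.1.2 = v)).Nonempty ↔ HasIn S v := by
      simp [Finset.Nonempty, HasIn, Fin.ext_iff]
    simp_rw [hne]
    rw [hsplit (fun v => if v = 0 then 1 else if HasIn S v then a v else b v) (by simp)]
    congr 1
    · refine Finset.prod_congr rfl fun u hu => ?_
      rw [Finset.mem_Ico] at hu
      simp [a, b, show u ≠ 0 by omega, show u ≠ n by omega]
    · simp [a, b, show n ≠ 0 by omega]
  rw [Finset.sum_congr rfl fun S _ => hterm S,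
    sum_prod_filter_fiber (fun e : KEdge n => e.1.2) (fun v T => (∏ e ∈ T, aliveWeight x A e) *
      if (v : ℕ) = 0 then 1 else if T.Nonempty then a v else b v)]
  have hv (v : Fin (n + 1)) :
      (∑ T ∈ (Finset.univ.filter fun e : KEdge n => e.1.2 = v).powerset,
        (∏ e ∈ T, aliveWeight x A e) *
          if (v : ℕ) = 0 then 1 else if T.Nonempty then a v else b v) =
      (fun v : ℕ => if v = 0 then 1 else a v * (x + 1) ^ aliveBelow A v - a v + b v) v := by
    dsimp only
    split_ifs with h0
    · have : (Finset.univ.filter fun e : KEdge n => e.1.2 = v) = ∅ := by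
        refine Finset.filter_eq_empty_iff.2 fun e _ he => ?_
        have h2 : (e.1.1 : ℕ) < e.1.2 := e.2
        rw [he] at h2
        omega
      simp [this]
    · rw [sum_powerset_nonempty, prod_one_add_aliveWeight]
  rw [Finset.prod_congr rfl fun v _ => hv v, hsplit (fun v => if v = 0 then 1 else
    a v * (x + 1) ^ aliveBelow A v - a v + b v) (by simp)]
  congr 1
  · refine Finset.prod_congr rfl fun u hu => ?_
    rw [Finset.mem_Ico] at hu
    simp only [a, b, show u ≠ 0 by omega, show u ≠ n by omega, if_false]
    split_ifs <;> ring
  · simp only [a, b, show n ≠ 0 by omega, if_false, if_true]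
    ring

end Counting

/-! ### The nonempty faces of `CRY n` are the flows supported in an admissible edge set -/

section FacesOfCRY

variable {n : ℕ} {S : Finset (KEdge n)}

/-- The net outflow at the first `n` vertices, as a linear map. -/
def net (n : ℕ) : (KEdge n → ℝ) →ₗ[ℝ] (Fin n → ℝ) where
  toFun f i := (∑ e : KEdge n with e.1.1 = i.castSucc, f e) -
    (∑ e : KEdge n with e.1.2 = i.castSucc, f e)
  map_add' f g := by
    funext i
    simp only [Pi.add_apply, Finset.sum_add_distrib]
    ring
  map_smul' c f := by
    funext i
    simp only [Pi.smul_apply, smul_eq_mul, ← Finset.mul_sum, RingHom.id_apply]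
    ring

/-- The netflow vector of `CRY n`. -/
def sourceFlow (n : ℕ) : Fin n → ℝ := fun i => if (i : ℕ) = 0 then 1 else 0

theorem mem_CRY {f : KEdge n → ℝ} : f ∈ CRY n ↔ (∀ e, 0 ≤ f e) ∧ net n f = sourceFlow n := by
  simp only [CRY, FlowPolytope, Set.mem_ofPred_eq, funext_iff, net, sourceFlow, LinearMap.coe_mk,
    AddHom.coe_mk]
  refine and_congr_right fun _ => forall_congr' fun i => ?_
  split_ifs <;> simp

theorem convex_CRY (n : ℕ) : Convex ℝ (CRY n) := by
  intro f hf g hg a b ha hb hab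
  rw [mem_CRY] at *
  refine ⟨fun e => ?_, ?_⟩
  · exact add_nonneg (mul_nonneg ha (hf.1 e)) (mul_nonneg hb (hg.1 e))
  · rw [map_add, map_smul, map_smul, hf.2, hg.2, ← add_smul, hab, one_smul]

/-- The flows of `CRY n` supported in the edge set `S`. -/
def flowFace (S : Finset (KEdge n)) : Set (KEdge n → ℝ) :=
  {f | f ∈ CRY n ∧ ∀ e ∉ S, f e = 0}

/-- The amount of flow through a vertex when one unit starts at the vertex `0` and every vertex
distributes its inflow equally among the edges of `S` leaving it. -/
noncomputable def throughput (S : Finset (KEdge n)) (v : Fin (n + 1)) : ℝ :=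
  if v = 0 then 1 else
    ∑ e ∈ (S.filter fun e => e.1.2 = v).attach,
      throughput S e.1.1.1 / (S.filter fun e' => e'.1.1 = e.1.1.1).card
termination_by v
decreasing_by
  have h := (Finset.mem_filter.1 e.2).2
  exact lt_of_lt_of_eq e.1.2 (congrArg Fin.val h)

/-- The flow in which every vertex distributes its inflow equally among the edges of `S` leaving
it. For admissible `S` its support is exactly `S`. -/
noncomputable def splitFlow (S : Finset (KEdge n)) (e : KEdge n) : ℝ :=
  if e ∈ S then throughput S e.1.1 / (S.filter fun e' => e'.1.1 = e.1.1).card else 0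

theorem throughput_zero (S : Finset (KEdge n)) : throughput S 0 = 1 := by
  rw [throughput, if_pos rfl]

theorem throughput_of_ne_zero (S : Finset (KEdge n)) {v : Fin (n + 1)} (hv : v ≠ 0) :
    throughput S v = ∑ e : KEdge n with e.1.2 = v, splitFlow S e := by
  rw [throughput, if_neg hv, Finset.sum_attach (S.filter fun e => e.1.2 = v)
    (fun e => throughput S e.1.1 / (S.filter fun e' => e'.1.1 = e.1.1).card)]
  simp only [splitFlow, ← Finset.sum_filter, Finset.filter_filter]
  refine Finset.sum_congr ?_ fun _ _ => rfl
  ext e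
  simp [and_comm]

theorem splitFlow_nonneg_of {e : KEdge n} (h : 0 ≤ throughput S e.1.1) : 0 ≤ splitFlow S e := by
  unfold splitFlow
  split_ifs
  · positivity
  · exact le_rfl

theorem throughput_nonneg (S : Finset (KEdge n)) (v : Fin (n + 1)) : 0 ≤ throughput S v := by
  induction v using WellFoundedLT.induction with
  | ind v ih =>
    by_cases hv : v = 0
    · rw [hv, throughput_zero]
      exact zero_le_one
    · rw [throughput_of_ne_zero S hv]
      refine Finset.sum_nonneg fun e he => splitFlow_nonneg_of (ih _ ?_)
      exact (Finset.mem_filter.1 he).2 ▸ e.2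

theorem splitFlow_nonneg (S : Finset (KEdge n)) (e : KEdge n) : 0 ≤ splitFlow S e :=
  splitFlow_nonneg_of (throughput_nonneg S _)

theorem splitFlow_pos_of {e : KEdge n} (he : e ∈ S) (h : 0 < throughput S e.1.1) :
    0 < splitFlow S e := by
  rw [splitFlow, if_pos he]
  have : 0 < (S.filter fun e' => e'.1.1 = e.1.1).card :=
    Finset.card_pos.2 ⟨e, Finset.mem_filter.2 ⟨he, rfl⟩⟩
  positivity

theorem Admissible.throughput_pos (h : Admissible S) (v : Fin (n + 1)) :
    ∀ e ∈ S, e.1.1 = v → 0 < throughput S v := by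
  induction v using WellFoundedLT.induction with
  | ind v ih =>
    rintro e he rfl
    by_cases hv : e.1.1 = 0
    · rw [hv, throughput_zero]
      exact zero_lt_one
    · obtain ⟨e', he', h'⟩ := (h.2 e he).1 hv
      rw [throughput_of_ne_zero S hv]
      refine Finset.sum_pos' (fun e _ => splitFlow_nonneg S e) ⟨e', by simpa using h', ?_⟩
      exact splitFlow_pos_of he' (ih _ (h' ▸ e'.2) e' he' rfl)

theorem Admissible.splitFlow_pos (h : Admissible S) {e : KEdge n} (he : e ∈ S) :
    0 < splitFlow S e :=
  splitFlow_pos_of he (h.throughput_pos _ e he rfl)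

theorem Admissible.sum_splitFlow_out (h : Admissible S) (i : Fin n) :
    ∑ e : KEdge n with e.1.1 = i.castSucc, splitFlow S e = throughput S i.castSucc := by
  have h1 : ∑ e : KEdge n with e.1.1 = i.castSucc, splitFlow S e =
      (S.filter fun e => e.1.1 = i.castSucc).card *
        (throughput S i.castSucc / (S.filter fun e => e.1.1 = i.castSucc).card) := by
    rw [← nsmul_eq_mul, ← Finset.sum_const]
    simp only [splitFlow, ← Finset.sum_filter, Finset.filter_filter]
    refine Finset.sum_congr ?_ fun e he => ?_
    · ext e
      simp [and_comm]
    · rw [(Finset.mem_filter.1 he).2]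
  rw [h1]
  rcases (S.filter fun e => e.1.1 = i.castSucc).eq_empty_or_nonempty with h0 | h0
  · -- nothing leaves the vertex, so nothing enters it
    have hno : ¬ ∃ e ∈ S, e.1.1 = i.castSucc := by
      rintro ⟨e, he, h'⟩
      exact Finset.filter_eq_empty_iff.1 h0 he h'
    have hi : i.castSucc ≠ 0 := by
      intro hi
      obtain ⟨e, he, h'⟩ := h.hasOut_zero
      exact hno ⟨e, he, by rw [hi]; exact Fin.ext h'⟩
    rw [throughput_of_ne_zero S hi, Finset.sum_eq_zero, zero_div, mul_zero]
    intro e he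
    have he := (Finset.mem_filter.1 he).2
    refine if_neg fun heS => hno ?_
    obtain ⟨e', he', h'⟩ := (h.2 e heS).2 (he ▸ (Fin.castSucc_lt_last i).ne)
    exact ⟨e', he', h'.trans he⟩
  · have : ((S.filter fun e => e.1.1 = i.castSucc).card : ℝ) ≠ 0 := by
      exact_mod_cast (Finset.card_pos.2 h0).ne'
    field_simp

theorem Admissible.splitFlow_mem (h : Admissible S) : splitFlow S ∈ flowFace S := by
  refine ⟨mem_CRY.2 ⟨splitFlow_nonneg S, ?_⟩, fun e he => if_neg he⟩
  funext i
  change (∑ e : KEdge n with e.1.1 = i.castSucc, splitFlow S e) - _ = _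
  rw [h.sum_splitFlow_out, sourceFlow]
  by_cases hi : i.castSucc = 0
  · have : (Finset.univ.filter fun e : KEdge n => e.1.2 = i.castSucc) = ∅ :=
      Finset.filter_eq_empty_iff.2 fun e _ he => absurd e.2 (by simp [he, hi])
    rw [this, Finset.sum_empty, hi, throughput_zero, if_pos (by simpa using congrArg Fin.val hi)]
    ring
  · rw [throughput_of_ne_zero S hi, if_neg (fun h0 : (i : ℕ) = 0 => hi (Fin.ext h0)), sub_self]

theorem admissible_support (hn : 1 ≤ n) {f : KEdge n → ℝ} (hf : f ∈ CRY n) :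
    Admissible (Finset.univ.filter fun e => 0 < f e) := by
  obtain ⟨h0, hnet⟩ := mem_CRY.1 hf
  have hflow (i : Fin n) : (∑ e : KEdge n with e.1.1 = i.castSucc, f e) -
      (∑ e : KEdge n with e.1.2 = i.castSucc, f e) = sourceFlow n i := congrFun hnet i
  -- a positive sum of flows over a set of edges contains a positive term
  have hex (p : KEdge n → Prop) [DecidablePred p] (hp : 0 < ∑ e : KEdge n with p e, f e) :
      ∃ e ∈ Finset.univ.filter (fun e => 0 < f e), p e := by
    obtain ⟨e, he, hpos⟩ := Finset.exists_lt_of_sum_lt (s := Finset.univ.filter p)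
      (f := fun _ => 0) (g := f) (by simpa using hp)
    exact ⟨e, by simpa using hpos, (Finset.mem_filter.1 he).2⟩
  have hge (p : KEdge n → Prop) [DecidablePred p] : 0 ≤ ∑ e : KEdge n with p e, f e :=
    Finset.sum_nonneg fun e _ => h0 e
  have hpos (p : KEdge n → Prop) [DecidablePred p] (e : KEdge n) (he : 0 < f e) (hp : p e) :
      0 < ∑ e : KEdge n with p e, f e :=
    Finset.sum_pos' (fun e _ => h0 e) ⟨e, by simpa using hp, he⟩
  refine ⟨?_, fun e he => ⟨fun hv => ?_, fun hv => ?_⟩⟩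
  · have h1 := hflow ⟨0, hn⟩
    rw [sourceFlow, if_pos rfl] at h1
    obtain ⟨e, he, -⟩ := hex _ (lt_of_lt_of_le zero_lt_one
      (h1.symm.le.trans (sub_le_self _ (hge _))))
    exact ⟨e, he⟩
  · have he := (Finset.mem_filter.1 he).2
    have hlast : e.1.1 ≠ Fin.last n := (e.2.trans_le (Fin.le_last _)).ne
    obtain ⟨i, hi⟩ := Fin.exists_castSucc_eq.2 hlast
    have h1 := hflow i
    rw [sourceFlow, if_neg (fun h => hv (by rw [← hi]; exact Fin.ext h))] at h1
    have h2 := hpos (fun e => e.1.1 = i.castSucc) e he hi.symm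
    obtain ⟨e', he', h'⟩ := hex (fun e => e.1.2 = i.castSucc) (by linarith)
    exact ⟨e', he', h'.trans hi⟩
  · have he := (Finset.mem_filter.1 he).2
    obtain ⟨i, hi⟩ := Fin.exists_castSucc_eq.2 hv
    have h1 := hflow i
    have h2 := hpos (fun e => e.1.2 = i.castSucc) e he hi.symm
    have h3 : 0 ≤ sourceFlow n i := by unfold sourceFlow; split_ifs <;> norm_num
    obtain ⟨e', he', h'⟩ := hex (fun e => e.1.1 = i.castSucc) (by linarith)
    exact ⟨e', he', h'.trans hi⟩

theorem exists_pos_mul_abs_le {E : Type*} (S : Finset E) (z g : E → ℝ) (hz : ∀ e ∈ S, 0 < z e) :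
    ∃ ε : ℝ, 0 < ε ∧ ∀ e ∈ S, ε * |g e| ≤ z e := by
  have h : ∀ᶠ ε : ℝ in nhdsWithin 0 (Set.Ioi 0), ∀ e ∈ S, ε * |g e| ≤ z e := by
    rw [Filter.eventually_all_finset]
    intro e he
    have ht : Filter.Tendsto (fun ε : ℝ => ε * |g e|) (nhds 0) (nhds (0 * |g e|)) :=
      (continuous_id.mul continuous_const).tendsto 0
    rw [zero_mul] at ht
    exact ((ht.eventually (gt_mem_nhds (hz e he))).filter_mono nhdsWithin_le_nhds).mono
      fun _ h => h.le
  obtain ⟨ε, h1, h2⟩ := (h.and self_mem_nhdsWithin).exists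
  exact ⟨ε, h2, h1⟩

/-- A flow with support `S` can be moved a little in any direction that is supported in `S` and
preserves the netflow. -/
theorem exists_add_smul_mem_flowFace {z g : KEdge n → ℝ} (hz : z ∈ flowFace S)
    (hpos : ∀ e ∈ S, 0 < z e) (hg : ∀ e ∉ S, g e = 0) (hnet : net n g = 0) :
    ∃ ε : ℝ, 0 < ε ∧ z + ε • g ∈ flowFace S := by
  obtain ⟨ε, hε, h⟩ := exists_pos_mul_abs_le S z g hpos
  refine ⟨ε, hε, mem_CRY.2 ⟨fun e => ?_, ?_⟩, fun e he => ?_⟩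
  · by_cases he : e ∈ S
    · have h1 := h e he
      have h2 : ε * -|g e| ≤ ε * g e := mul_le_mul_of_nonneg_left (neg_abs_le _) hε.le
      simp only [Pi.add_apply, Pi.smul_apply, smul_eq_mul]
      linarith
    · simp [hg e he, hz.2 e he]
  · rw [map_add, map_smul, hnet, smul_zero, add_zero, (mem_CRY.1 hz.1).2]
  · simp [hg e he, hz.2 e he]

theorem isExposed_flowFace (S : Finset (KEdge n)) : IsExposed ℝ (CRY n) (flowFace S) := by
  rintro ⟨z, hz⟩
  have hl (f : KEdge n → ℝ) : (-∑ e ∈ Sᶜ, ContinuousLinearMap.proj (R := ℝ) e :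
      StrongDual ℝ (KEdge n → ℝ)) f = -∑ e ∈ Sᶜ, f e := by
    simp
  refine ⟨-∑ e ∈ Sᶜ, ContinuousLinearMap.proj (R := ℝ) e, ?_⟩
  simp only [hl]
  ext f
  constructor
  · rintro ⟨hf, hS⟩
    refine ⟨hf, fun g hg => neg_le_neg ?_⟩
    rw [Finset.sum_eq_zero fun e he => hS e (Finset.mem_compl.1 he)]
    exact Finset.sum_nonneg fun e _ => (mem_CRY.1 hg).1 e
  · rintro ⟨hf, hmax⟩
    refine ⟨hf, fun e he => ?_⟩
    have h1 := hmax z hz.1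
    rw [Finset.sum_eq_zero fun e he => hz.2 e (Finset.mem_compl.1 he), neg_zero,
      Left.nonneg_neg_iff] at h1
    have h2 : ∀ e ∈ Sᶜ, 0 ≤ f e := fun e _ => (mem_CRY.1 hf).1 e
    exact (Finset.sum_eq_zero_iff_of_nonneg h2).1 (le_antisymm h1 (Finset.sum_nonneg h2)) e
      (Finset.mem_compl.2 he)

/-- If `z` is a point of largest support `S` in a nonempty exposed face, the functional is constant
on `flowFace S`: it is bounded by its value at `z` on both sides of `z`. -/
theorem exists_eq_flowFace (hn : 1 ≤ n) {F : Set (KEdge n → ℝ)} (hF : IsExposed ℝ (CRY n) F)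
    (hne : F.Nonempty) : ∃ S : Finset (KEdge n), Admissible S ∧ F = flowFace S := by
  have hconv : Convex ℝ F := hF.convex (convex_CRY n)
  obtain ⟨l, hl⟩ := hF hne
  set supp : (KEdge n → ℝ) → Finset (KEdge n) := fun f => Finset.univ.filter fun e => 0 < f e
  obtain ⟨_, ⟨z, hzF, rfl⟩, hmax⟩ := Set.exists_max_image (supp '' F) Finset.card
    (Set.toFinite _) (hne.image supp)
  have hzP : z ∈ CRY n := by rw [hl] at hzF; exact hzF.1
  have hz_max : ∀ y ∈ CRY n, l y ≤ l z := by rw [hl] at hzF; exact hzF.2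
  have hnonneg : ∀ f ∈ F, ∀ e, 0 ≤ f e := fun f hf => by
    rw [hl] at hf
    exact (mem_CRY.1 hf.1).1
  have hsupp : ∀ f ∈ F, supp f ⊆ supp z := by
    intro f hf
    have hm := hconv hf hzF (a := 1 / 2) (b := 1 / 2) (by norm_num) (by norm_num) (by norm_num)
    have hpos (e : KEdge n) : 0 < ((1 / 2 : ℝ) • f + (1 / 2 : ℝ) • z) e ↔ 0 < f e ∨ 0 < z e := by
      have h1 := hnonneg f hf e
      have h2 := hnonneg z hzF e
      simp only [Pi.add_apply, Pi.smul_apply, smul_eq_mul]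
      constructor
      · intro h
        by_contra! hc
        linarith
      · rintro (h | h) <;> linarith
    have hsub : supp z ⊆ supp ((1 / 2 : ℝ) • f + (1 / 2 : ℝ) • z) := fun e he =>
      Finset.mem_filter.2 ⟨Finset.mem_univ _, (hpos e).2 (Or.inr (Finset.mem_filter.1 he).2)⟩
    rw [Finset.eq_of_subset_of_card_le hsub (hmax _ ⟨_, hm, rfl⟩)]
    exact fun e he =>
      Finset.mem_filter.2 ⟨Finset.mem_univ _, (hpos e).2 (Or.inl (Finset.mem_filter.1 he).2)⟩
  have hface : ∀ f ∈ F, f ∈ flowFace (supp z) := by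
    intro f hf
    refine ⟨by rw [hl] at hf; exact hf.1, fun e he => ?_⟩
    have h1 : ¬ 0 < f e := fun h => he (hsupp f hf (by simpa [supp] using h))
    exact le_antisymm (not_lt.1 h1) (hnonneg f hf e)
  refine ⟨supp z, admissible_support hn hzP, Set.Subset.antisymm hface fun x hx => ?_⟩
  obtain ⟨ε, hε, hy⟩ := exists_add_smul_mem_flowFace (S := supp z) (g := z - x) (hface z hzF)
    (fun e he => (Finset.mem_filter.1 he).2)
    (fun e he => by simp [(hface z hzF).2 e he, hx.2 e he])
    (by rw [map_sub, (mem_CRY.1 hzP).2, (mem_CRY.1 hx.1).2, sub_self])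
  have h1 := hz_max _ hy.1
  rw [map_add, map_smul, map_sub, smul_eq_mul] at h1
  have h2 : l z ≤ l x := by
    by_contra! h
    have := mul_pos hε (sub_pos.2 h)
    linarith
  rw [hl]
  exact ⟨hx.1, fun y hy => (hz_max y hy).trans h2⟩

theorem flowFace_injOn : Set.InjOn (flowFace (n := n)) {S | Admissible S} := by
  have key {S T : Finset (KEdge n)} (hS : Admissible S) (h : flowFace S = flowFace T) :
      S ⊆ T := by
    intro e he
    by_contra hT
    have : splitFlow S ∈ flowFace T := h ▸ hS.splitFlow_mem
    exact (hS.splitFlow_pos he).ne' (this.2 e hT)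
  exact fun S hS T hT h => (key hS h).antisymm (key hT h.symm)

theorem faces_CRY (hn : 1 ≤ n) :
    faces (CRY n) = insert ∅ (flowFace '' {S | Admissible S}) := by
  ext F
  constructor
  · intro hF
    rcases F.eq_empty_or_nonempty with rfl | hne
    · exact Set.mem_insert _ _
    · obtain ⟨S, hS, rfl⟩ := exists_eq_flowFace hn hF hne
      exact Set.mem_insert_of_mem _ ⟨S, hS, rfl⟩
  · rintro (rfl | ⟨S, -, rfl⟩)
    · exact fun h => absurd h Set.not_nonempty_empty
    · exact isExposed_flowFace S

end FacesOfCRY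

/-! ### The dimension of a face -/

section Dimension

variable {n : ℕ} {S : Finset (KEdge n)}

/-- The directions in which a flow with support `S` can be moved: the circulations on `S`. -/
def circulations (S : Finset (KEdge n)) : Submodule ℝ (KEdge n → ℝ) where
  carrier := {g | (∀ e ∉ S, g e = 0) ∧ net n g = 0}
  add_mem' := by
    rintro f g ⟨hf, hf'⟩ ⟨hg, hg'⟩
    exact ⟨fun e he => by simp [hf e he, hg e he], by rw [map_add, hf', hg', add_zero]⟩
  zero_mem' := ⟨fun _ _ => rfl, map_zero _⟩
  smul_mem' := by
    rintro c f ⟨hf, hf'⟩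
    exact ⟨fun e he => by simp [hf e he], by rw [map_smul, hf', smul_zero]⟩

theorem Admissible.direction_flowFace (h : Admissible S) :
    (affineSpan ℝ (flowFace S)).direction = circulations S := by
  rw [direction_affineSpan]
  apply le_antisymm
  · rw [vectorSpan_def, Submodule.span_le]
    rintro _ ⟨f, hf, g, hg, rfl⟩
    refine ⟨fun e he => by simp [hf.2 e he, hg.2 e he], ?_⟩
    change net n (f - g) = 0
    rw [map_sub, (mem_CRY.1 hf.1).2, (mem_CRY.1 hg.1).2, sub_self]
  · rintro g ⟨hg, hg'⟩
    obtain ⟨ε, hε, hy⟩ := exists_add_smul_mem_flowFace h.splitFlow_mem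
      (fun e he => h.splitFlow_pos he) hg hg'
    have h1 := vsub_mem_vectorSpan ℝ hy h.splitFlow_mem
    have h2 := Submodule.smul_mem _ ε⁻¹ h1
    rwa [vsub_eq_sub, add_sub_cancel_left, smul_smul, inv_mul_cancel₀ hε.ne', one_smul] at h2

theorem net_single (e : KEdge n) (i : Fin n) : net n (Pi.single e 1) i =
    (if e.1.1 = i.castSucc then 1 else 0) - if e.1.2 = i.castSucc then 1 else 0 := by
  have h (p : KEdge n → Prop) [DecidablePred p] :
      ∑ e' : KEdge n with p e', (Pi.single e 1 : KEdge n → ℝ) e' = if p e then 1 else 0 := by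
    rw [Finset.sum_pi_single']
    simp
  simp only [net, LinearMap.coe_mk, AddHom.coe_mk, h]

/-- The functions on the edge set `S`, extended by zero. -/
noncomputable def extendEdges (S : Finset (KEdge n)) : (S → ℝ) →ₗ[ℝ] (KEdge n → ℝ) :=
  Function.ExtendByZero.linearMap ℝ (Subtype.val : S → KEdge n)

theorem extendEdges_apply_of_notMem (f : S → ℝ) {e : KEdge n} (he : e ∉ S) :
    extendEdges S f e = 0 :=
  Function.extend_apply' _ _ _ (by rintro ⟨e', rfl⟩; exact he e'.2)

theorem extendEdges_apply (f : S → ℝ) (e : S) : extendEdges S f e = f e :=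
  Subtype.val_injective.extend_apply _ _ e

theorem extendEdges_injective : Function.Injective (extendEdges S) := by
  intro f g h
  funext e
  rw [← extendEdges_apply f, h, extendEdges_apply]

theorem extendEdges_restrict {g : KEdge n → ℝ} (hg : ∀ e ∉ S, g e = 0) :
    extendEdges S (fun e => g e) = g := by
  funext e
  by_cases he : e ∈ S
  · exact extendEdges_apply (S := S) (fun e => g e) ⟨e, he⟩
  · rw [extendEdges_apply_of_notMem _ he, hg e he]

theorem map_ker_extendEdges :
    (LinearMap.ker (net n ∘ₗ extendEdges S)).map (extendEdges S) = circulations S := by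
  ext g
  constructor
  · rintro ⟨f, hf, rfl⟩
    exact ⟨fun e he => extendEdges_apply_of_notMem f he, hf⟩
  · rintro ⟨hg, hg'⟩
    exact ⟨_, by simpa [extendEdges_restrict hg] using hg', extendEdges_restrict hg⟩

/-- The vertices other than the sink from which an edge of `S` leaves. -/
def innerTails (S : Finset (KEdge n)) : Finset (Fin n) :=
  Finset.univ.filter fun i => i.castSucc ∈ tails S

theorem card_innerTails (S : Finset (KEdge n)) : (innerTails S).card = (tails S).card := by
  rw [← Finset.card_map Fin.castSuccEmb]
  congr 1
  ext v
  simp only [innerTails, Finset.mem_map, Finset.mem_filter, Finset.mem_univ, true_and,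
    Fin.coe_castSuccEmb]
  constructor
  · rintro ⟨i, hi, rfl⟩
    exact hi
  · intro hv
    obtain ⟨e, he, rfl⟩ := Finset.mem_image.1 hv
    obtain ⟨i, hi⟩ := Fin.exists_castSucc_eq.2 (e.2.trans_le (Fin.le_last _)).ne
    exact ⟨i, hi ▸ hv, hi⟩

theorem mem_innerTails {i : Fin n} : i ∈ innerTails S ↔ ∃ e ∈ S, e.1.1 = i.castSucc := by
  simp [innerTails, tails]

/-- An edge of `S` leaving the vertex `i` reaches the sink or a later vertex that an edge of `S`
leaves, so that the unit vectors at the tails are netflows by descending induction. -/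
theorem Admissible.single_mem_range (h : Admissible S) (i : Fin n) (hi : i ∈ innerTails S) :
    (Pi.single i 1 : Fin n → ℝ) ∈ LinearMap.range (net n ∘ₗ extendEdges S) := by
  induction i using WellFoundedGT.induction with
  | ind i ih =>
    obtain ⟨e, he, hei⟩ := mem_innerTails.1 hi
    have hmem : net n (Pi.single e 1) ∈ LinearMap.range (net n ∘ₗ extendEdges S) := by
      refine ⟨fun e' => (Pi.single e 1 : KEdge n → ℝ) e', ?_⟩
      rw [LinearMap.comp_apply, extendEdges_restrict]
      intro e' he'
      exact Pi.single_eq_of_ne (fun h' : e' = e => he' (h'.symm ▸ he)) 1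
    by_cases hl : e.1.2 = Fin.last n
    · convert hmem using 1
      funext k
      rw [net_single, hei, hl, if_neg (Fin.castSucc_lt_last k).ne', Pi.single_apply]
      simp [eq_comm]
    · obtain ⟨j, hj⟩ := Fin.exists_castSucc_eq.2 hl
      obtain ⟨e', he', h'⟩ := (h.2 e he).2 hl
      have hij : i < j := by
        have := e.2
        rwa [hei, ← hj, Fin.castSucc_lt_castSucc_iff] at this
      have hjr := ih j hij (mem_innerTails.2 ⟨e', he', h'.trans hj.symm⟩)
      convert Submodule.add_mem _ hmem hjr using 1
      funext k
      rw [Pi.add_apply, net_single, hei, ← hj, Pi.single_apply, Pi.single_apply]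
      simp [eq_comm]

theorem Admissible.range_net (h : Admissible S) :
    LinearMap.range (net n ∘ₗ extendEdges S) =
      LinearMap.range (Function.ExtendByZero.linearMap ℝ
        (Subtype.val : innerTails S → Fin n)) := by
  apply le_antisymm
  · rintro _ ⟨f, rfl⟩
    refine ⟨fun i => net n (extendEdges S f) i, ?_⟩
    funext i
    rw [Function.ExtendByZero.linearMap_apply]
    by_cases hi : i ∈ innerTails S
    · exact Subtype.val_injective.extend_apply _ _ (⟨i, hi⟩ : innerTails S)
    · rw [Function.extend_apply' _ _ _ (by rintro ⟨e', rfl⟩; exact hi e'.2)]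
      have h1 : ∀ e : KEdge n, e.1.1 = i.castSucc → extendEdges S f e = 0 := fun e he =>
        extendEdges_apply_of_notMem f fun heS => hi (mem_innerTails.2 ⟨e, heS, he⟩)
      have h2 : ∀ e : KEdge n, e.1.2 = i.castSucc → extendEdges S f e = 0 := fun e he =>
        extendEdges_apply_of_notMem f fun heS => by
          obtain ⟨e', he', h'⟩ := (h.2 e heS).2 (he ▸ (Fin.castSucc_lt_last i).ne)
          exact hi (mem_innerTails.2 ⟨e', he', h'.trans he⟩)
      change 0 = (∑ e : KEdge n with e.1.1 = i.castSucc, extendEdges S f e) -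
        (∑ e : KEdge n with e.1.2 = i.castSucc, extendEdges S f e)
      rw [Finset.sum_eq_zero fun e he => h1 e (Finset.mem_filter.1 he).2,
        Finset.sum_eq_zero fun e he => h2 e (Finset.mem_filter.1 he).2, sub_zero]
  · rintro _ ⟨f, rfl⟩
    rw [pi_eq_sum_univ' (Function.ExtendByZero.linearMap ℝ Subtype.val f)]
    refine Submodule.sum_mem _ fun i _ => ?_
    by_cases hi : i ∈ innerTails S
    · convert Submodule.smul_mem _ _ (h.single_mem_range i hi) using 2
    · rw [Function.ExtendByZero.linearMap_apply,
        Function.extend_apply' _ _ _ (by rintro ⟨e', rfl⟩; exact hi e'.2), Pi.zero_apply, zero_smul]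
      exact Submodule.zero_mem _

/-- Rank-nullity for the netflow map on the edges of `S`. -/
theorem Admissible.finrank_circulations (h : Admissible S) :
    Module.finrank ℝ (circulations S) + (tails S).card = S.card := by
  have h1 := LinearMap.finrank_range_add_finrank_ker (net n ∘ₗ extendEdges S)
  rw [h.range_net, LinearMap.finrank_range_of_inj
    (Function.extend_injective Subtype.val_injective _)] at h1
  rw [← map_ker_extendEdges, 
    ← (Submodule.equivMapOfInjective _ extendEdges_injective _).finrank_eq, ← card_innerTails]
  simpa [add_comm] using h1

theorem Admissible.faceDim_flowFace (h : Admissible S) :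
    faceDim (flowFace S) = (S.card : ℤ) - (tails S).card := by
  have h1 := h.finrank_circulations
  rw [faceDim, if_neg (Set.Nonempty.ne_empty ⟨_, h.splitFlow_mem⟩), h.direction_flowFace]
  omega

end Dimension

/-! ### Admissible edge sets are the edge sets of the graphs in `Omega n` -/

section PathGraphs

theorem exists_rel_of_mem_of_head? {α : Type*} {r : α → α → Prop} {p : List α} {a v : α}
    (hp : p.IsChain r) (ha : p.head? = some a) (hv : v ∈ p) (hne : v ≠ a) : ∃ u, r u v := by
  induction p generalizing a with
  | nil => simp at hv
  | cons b p ih =>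
    obtain rfl : b = a := by simpa using ha
    have hv' : v ∈ p := (List.mem_cons.1 hv).resolve_left hne
    rcases p with _ | ⟨c, p⟩
    · simp at hv'
    · rw [List.isChain_cons_cons] at hp
      by_cases hc : v = c
      · exact ⟨b, hc ▸ hp.1⟩
      · exact ih hp.2 rfl hv' hc

theorem exists_rel_of_mem_of_getLast? {α : Type*} {r : α → α → Prop} {p : List α} {a v : α}
    (hp : p.IsChain r) (ha : p.getLast? = some a) (hv : v ∈ p) (hne : v ≠ a) : ∃ u, r v u := by
  have h := exists_rel_of_mem_of_head? (r := flip r) (p := p.reverse)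
    (List.isChain_reverse.2 hp) (by simpa using ha) (List.mem_reverse.2 hv) hne
  exact h

/-- A walk from `u` to `v` can be put in front of a path that starts at `v`. -/
theorem exists_isChain_of_reflTransGen {α : Type*} {r : α → α → Prop} {u v w : α}
    (h : Relation.ReflTransGen r u v) {p : List α} (hp : p.IsChain r) (hv : p.head? = some v)
    (hw : p.getLast? = some w) :
    ∃ p' : List α, p'.IsChain r ∧ p'.head? = some u ∧ p'.getLast? = some w ∧ v ∈ p' := by
  induction h using Relation.ReflTransGen.head_induction_on with
  | refl => exact ⟨p, hp, hv, hw, List.mem_of_mem_head? hv⟩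
  | head hab _ ih =>
    obtain ⟨p', h1, h2, h3, h4⟩ := ih
    rcases p' with _ | ⟨c, p'⟩
    · simp at h4
    · obtain rfl := Option.some.inj h2
      exact ⟨_ :: c :: p', List.isChain_cons_cons.2 ⟨hab, h1⟩, rfl, by simpa using h3,
        List.mem_cons_of_mem _ h4⟩

variable {n : ℕ}

theorem exists_edge_to_of_mem_Omega {H : KSubgraph n} (hH : H ∈ Omega n) {v : Fin (n + 1)}
    (hv : v ∈ H.verts) (h0 : v ≠ 0) : ∃ e ∈ H.edges, e.1.2 = v := by
  obtain ⟨p, hp, hvp⟩ := hH v hv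
  obtain ⟨u, h, he⟩ := exists_rel_of_mem_of_head? hp.1 hp.2.1 hvp h0
  exact ⟨_, he, rfl⟩

theorem exists_edge_from_of_mem_Omega {H : KSubgraph n} (hH : H ∈ Omega n) {v : Fin (n + 1)}
    (hv : v ∈ H.verts) (hl : v ≠ Fin.last n) : ∃ e ∈ H.edges, e.1.1 = v := by
  obtain ⟨p, hp, hvp⟩ := hH v hv
  obtain ⟨u, h, he⟩ := exists_rel_of_mem_of_getLast? hp.1 hp.2.2 hvp hl
  exact ⟨_, he, rfl⟩

theorem mem_verts_iff_of_mem_Omega (hn : 1 ≤ n) {H : KSubgraph n} (hH : H ∈ Omega n)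
    (v : Fin (n + 1)) : v ∈ H.verts ↔ ∃ e ∈ H.edges, e.1.1 = v ∨ e.1.2 = v := by
  constructor
  · intro hv
    by_cases h0 : v = 0
    · have hl : v ≠ Fin.last n := by
        rw [h0]
        intro h
        have := congrArg Fin.val h
        simp at this
        omega
      obtain ⟨e, he, h⟩ := exists_edge_from_of_mem_Omega hH hv hl
      exact ⟨e, he, Or.inl h⟩
    · obtain ⟨e, he, h⟩ := exists_edge_to_of_mem_Omega hH hv h0
      exact ⟨e, he, Or.inr h⟩
  · rintro ⟨e, he, rfl | rfl⟩
    · exact H.fst_mem e he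
    · exact H.snd_mem e he

/-- The subgraph with a given nonempty edge set and no isolated vertices. -/
def KSubgraph.ofEdges (S : Finset (KEdge n)) (hS : S.Nonempty) : KSubgraph n where
  verts := {v | ∃ e ∈ S, e.1.1 = v ∨ e.1.2 = v}
  edges := S
  nonempty := let ⟨e, he⟩ := hS; ⟨e.1.1, e, he, Or.inl rfl⟩
  fst_mem e he := ⟨e, he, Or.inl rfl⟩
  snd_mem e he := ⟨e, he, Or.inr rfl⟩

theorem Admissible.ofEdges_mem_Omega {S : Finset (KEdge n)} (h : Admissible S) :
    KSubgraph.ofEdges S h.1 ∈ Omega n := by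
  set H := KSubgraph.ofEdges S h.1
  have hadj (e : KEdge n) (he : e ∈ S) : H.Adj e.1.1 e.1.2 := ⟨e.2, he⟩
  have hfrom (v : Fin (n + 1)) : v ∈ H.verts → Relation.ReflTransGen H.Adj 0 v := by
    induction v using WellFoundedLT.induction with
    | ind v ih =>
      rintro ⟨e, he, hev⟩
      by_cases h0 : v = 0
      · rw [h0]
      · obtain ⟨e', he', h'⟩ : ∃ e' ∈ S, e'.1.2 = v := by
          rcases hev with rfl | h'
          · exact (h.2 e he).1 h0
          · exact ⟨e, he, h'⟩
        subst h'
        exact (ih _ e'.2 ⟨e', he', Or.inl rfl⟩).tail (hadj e' he')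
  have hto (v : Fin (n + 1)) : v ∈ H.verts → Relation.ReflTransGen H.Adj v (Fin.last n) := by
    induction v using WellFoundedGT.induction with
    | ind v ih =>
      rintro ⟨e, he, hev⟩
      by_cases hl : v = Fin.last n
      · rw [hl]
      · obtain ⟨e', he', h'⟩ : ∃ e' ∈ S, e'.1.1 = v := by
          rcases hev with h' | rfl
          · exact ⟨e, he, h'⟩
          · exact (h.2 e he).2 hl
        subst h'
        exact (ih _ e'.2 ⟨e', he', Or.inr rfl⟩).head (hadj e' he')
  intro v hv
  obtain ⟨p, h1, h2, h3, -⟩ := exists_isChain_of_reflTransGen (hto v hv)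
    (List.isChain_singleton (Fin.last n)) rfl rfl
  obtain ⟨p', h1', h2', h3', h4'⟩ := exists_isChain_of_reflTransGen (hfrom v hv) h1 h2 h3
  exact ⟨p', ⟨h1', h2', h3'⟩, h4'⟩

open Classical in
theorem ncard_Omega (hn : 1 ≤ n) :
    (Omega n).ncard = (Finset.univ.filter fun S : Finset (KEdge n) => Admissible S).card := by
  rw [← Set.ncard_coe_finset]
  refine Set.ncard_congr (fun H _ => H.edges.toFinset) ?_ ?_ ?_
  · intro H hH
    simp only [Finset.coe_filter, Finset.mem_univ, true_and, Set.mem_ofPred_eq]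
    refine ⟨?_, fun e he => ?_⟩
    · obtain ⟨v, hv⟩ := H.nonempty
      obtain ⟨e, he, -⟩ := (mem_verts_iff_of_mem_Omega hn hH v).1 hv
      exact ⟨e, Set.mem_toFinset.2 he⟩
    · simp only [Set.mem_toFinset] at he ⊢
      exact ⟨exists_edge_to_of_mem_Omega hH (H.fst_mem e he),
        exists_edge_from_of_mem_Omega hH (H.snd_mem e he)⟩
  · intro H H' hH hH' h
    have he : H.edges = H'.edges := Set.toFinset_inj.1 h
    refine KSubgraph.ext (Set.ext fun v => ?_) he
    rw [mem_verts_iff_of_mem_Omega hn hH, mem_verts_iff_of_mem_Omega hn hH', he]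
  · intro S hS
    have hS : Admissible S := by simpa using hS
    exact ⟨KSubgraph.ofEdges S hS.1, hS.ofEdges_mem_Omega, by simp [KSubgraph.ofEdges]⟩

end PathGraphs

/-! ### The `f`-polynomial -/

theorem faceDim_mono {E : Type*} [AddCommGroup E] [Module ℝ E] [FiniteDimensional ℝ E]
    {F P : Set E} (h : F ⊆ P) : faceDim F ≤ faceDim P := by
  unfold faceDim
  split_ifs with h1 h2 h2
  · exact le_rfl
  · omega
  · exact absurd (Set.subset_empty_iff.1 (h2 ▸ h)) h1
  · exact_mod_cast Submodule.finrank_mono (AffineSubspace.direction_le (affineSpan_mono ℝ h))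

theorem neg_one_le_faceDim {E : Type*} [AddCommGroup E] [Module ℝ E] (F : Set E) :
    -1 ≤ faceDim F := by
  unfold faceDim
  split_ifs
  · exact le_rfl
  · omega

/-- The range of summation in `fPolynomial` loses no face: dimensions lie between `-1` and the
dimension of `P`. -/
theorem fPolynomial_eq_sum {E : Type*} [AddCommGroup E] [Module ℝ E] [TopologicalSpace E]
    [FiniteDimensional ℝ E] {P : Set E} (hP : (faces P).Finite) :
    fPolynomial P = ∑ F ∈ hP.toFinset, LaurentPolynomial.T (faceDim F) := by
  classical
  have hmaps : ∀ F ∈ hP.toFinset, faceDim F ∈ Finset.Icc (-1) (faceDim P) := by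
    intro F hF
    have hF : IsExposed ℝ P F := hP.mem_toFinset.1 hF
    exact Finset.mem_Icc.2 ⟨neg_one_le_faceDim F, faceDim_mono hF.subset⟩
  rw [← Finset.sum_fiberwise_of_maps_to hmaps, fPolynomial]
  refine Finset.sum_congr rfl fun d _ => ?_
  have h1 : {F | F ∈ faces P ∧ faceDim F = d} =
      (hP.toFinset.filter fun F => faceDim F = d : Finset (Set E)) := by
    ext F
    simp
  rw [fVector, h1, Set.ncard_coe_finset, ← nsmul_eq_mul, ← Finset.sum_const]
  exact Finset.sum_congr rfl fun F hF => by rw [(Finset.mem_filter.1 hF).2]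

theorem finite_faces_CRY {n : ℕ} (hn : 1 ≤ n) : (faces (CRY n)).Finite := by
  rw [faces_CRY hn]
  exact ((Set.toFinite _).image _).insert _

open Classical in
theorem fPolynomial_CRY {n : ℕ} (hn : 1 ≤ n) :
    fPolynomial (CRY n) = LaurentPolynomial.T (-1) +
      ∑ S : Finset (KEdge n) with Admissible S,
        LaurentPolynomial.T ((S.card : ℤ) - (tails S).card) := by
  rw [fPolynomial_eq_sum (finite_faces_CRY hn)]
  have h1 : (finite_faces_CRY hn).toFinset =
      insert ∅ ((Finset.univ.filter fun S : Finset (KEdge n) => Admissible S).image flowFace) := by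
    ext F
    simp [faces_CRY hn]
  have h2 : ∅ ∉ (Finset.univ.filter fun S : Finset (KEdge n) => Admissible S).image flowFace := by
    intro h
    obtain ⟨S, hS, h⟩ := Finset.mem_image.1 h
    exact Set.Nonempty.ne_empty ⟨_, (Finset.mem_filter.1 hS).2.splitFlow_mem⟩ h
  rw [h1, Finset.sum_insert h2, Finset.sum_image]
  · congr 1
    · rw [faceDim, if_pos rfl]
    · exact Finset.sum_congr rfl fun S hS => by rw [(Finset.mem_filter.1 hS).2.faceDim_flowFace]
  · intro S hS T hT h
    exact flowFace_injOn (by simpa using hS) (by simpa using hT) h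

theorem fPolynomial_CRY_eq {n : ℕ} (hn : 1 ≤ n) :
    fPolynomial (CRY n) =
      LaurentPolynomial.T (-1) + LaurentPolynomial.T (-(n : ℤ)) *
        ∑ m ∈ Finset.range n,
          (-1) ^ m * (1 + LaurentPolynomial.T 1) ^ m *
            piProd (n - m) (LaurentPolynomial.T 1) *
            hEval m (n - m - 1) (LaurentPolynomial.T 1) := by
  classical
  rw [fPolynomial_CRY hn, ← sum_admissible _ hn, Finset.mul_sum]
  congr 1
  refine Finset.sum_congr rfl fun S _ => ?_
  have h := tails_card_le S
  rw [LaurentPolynomial.T_pow, LaurentPolynomial.T_pow, ← LaurentPolynomial.T_add,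
    ← LaurentPolynomial.T_add]
  congr 1
  push_cast [h]
  ring

theorem eval_one_fPolynomial_CRY {n : ℕ} (hn : 1 ≤ n) :
    LaurentPolynomial.eval₂ (RingHom.id ℤ) (1 : ℤˣ) (fPolynomial (CRY n)) =
      1 + ((Omega n).ncard : ℤ) := by
  classical
  rw [fPolynomial_CRY hn, ncard_Omega hn, map_add, map_sum]
  simp only [LaurentPolynomial.eval₂_T, one_zpow, Units.val_one, Finset.sum_const, nsmul_eq_mul,
    mul_one]

theorem ncard_Omega_eq {n : ℕ} (hn : 1 ≤ n) :
    ((Omega n).ncard : ℤ) =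
      ∑ m ∈ Finset.range n,
        (-2) ^ m * piProd (n - m) (1 : ℤ) * hEval m (n - m - 1) (1 : ℤ) := by
  classical
  have h := sum_admissible (n := n) (1 : ℤ) hn
  simp only [one_pow, mul_one, Finset.sum_const, nsmul_eq_mul] at h
  rw [ncard_Omega hn, h]
  refine Finset.sum_congr rfl fun m _ => ?_
  rw [← mul_pow]
  norm_num

theorem mainTheorem2 (n : ℕ) (hn : 1 ≤ n) :
    (faces (CRY n)).Finite ∧
    (fPolynomial (CRY n) =
      LaurentPolynomial.T (-1) + LaurentPolynomial.T (-(n : ℤ)) *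
        ∑ m ∈ Finset.range n,
          (-1) ^ m * (1 + LaurentPolynomial.T 1) ^ m *
            piProd (n - m) (LaurentPolynomial.T 1) *
            hEval m (n - m - 1) (LaurentPolynomial.T 1)) ∧
    (2 ≤ n → fPolynomial (CRY n) =
      LaurentPolynomial.T (-1) + LaurentPolynomial.T (-(n : ℤ)) *
        ∑ m ∈ Finset.Icc 0 (n - 2),
          (-1) ^ m * (1 + LaurentPolynomial.T 1) ^ m *
            piProd (n - m) (LaurentPolynomial.T 1) *
            hEval m (n - m - 1) (LaurentPolynomial.T 1)) ∧
    LaurentPolynomial.eval₂ (RingHom.id ℤ) (1 : ℤˣ) (fPolynomial (CRY n)) =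
      1 + ((Omega n).ncard : ℤ) ∧
    ((Omega n).ncard : ℤ) =
      ∑ m ∈ Finset.range n, (-2) ^ m * piProd (n - m) (1 : ℤ) * hEval m (n - m - 1) (1 : ℤ) := by
  refine ⟨finite_faces_CRY hn, fPolynomial_CRY_eq hn, fun h2 => ?_,
    eval_one_fPolynomial_CRY hn, ncard_Omega_eq hn⟩
  rw [fPolynomial_CRY_eq hn]
  obtain ⟨k, rfl⟩ : ∃ k, n = k + 2 := ⟨n - 2, by omega⟩
  -- the term `m = n - 1` contains `h_{n-1}` of no variables
  rw [Finset.sum_range_succ, show k + 2 - (k + 1) - 1 = 0 by omega, hEval_succ_zero, mul_zero,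
    add_zero, Nat.add_sub_cancel, Nat.range_succ_eq_Icc_zero]
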